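/- For $k\in\{1,2,\dots\}$ let $\mathbb{Z}_k$ be the integers modulo $k$, and let $\mathbb{Z}_\infty=\mathbb{Z}$. Let $S$ be a finite set of states, let $\tau:S^3\to S$ be an arbitrary function (a one-dimensional nearest-neighbor rule), let $m,N\in\{1,2,\dots\}\cup\{\infty\}$, and let $\mathbb{A}=\mathbb{Z}_N$ and $\mathbb{C}=\mathbb{Z}_m^2\times\mathbb{A}$. The three-dimensional rule $\tau'$ on $\mathbb{C}$ is defined as follows. For a configuration $c:\mathbb{C}\to S$ put $$M_c(a,b,u)=\mathrm{Maj}\bigl(c(a,b,u),\,c(a+1,b,u),\,c(a,b+1,u)\bigr),$$ where $\mathrm{Maj}$ is the majority of three states (with an arbitrary fixed tie-breaking function when all three differ). The rule maps $c$ to $$(\tau' c)(a,b,u)=\tau\bigl(M_c(a,b,u-1),\,M_c(a,b,u),\,M_c(a,b,u+1)\bigr).$$ Let $I\subseteq\{0,1,2,\dots\}$ be an interval of times containing $0$. Let $\zeta:\mathbb{A}\times I\to S$ be a trajectory of $\tau$, that is, $\zeta(u,t+1)=\tau(\zeta(u-1,t),\zeta(u,t),\zeta(u+1,t))$ whenever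 $t,t+1\in I$, and put $\zeta'(i,j,u,t)=\zeta(u,t)$ on $\mathbb{C}\times I$. Let $\varepsilon\ge 0$ and let $\eta$ be a random space-time configuration $\mathbb{C}\times I\to S$ which is a trajectory of the $\varepsilon$-perturbation of $\tau'$: for every site $w\in\mathbb{C}$ and all $t,t+1\in I$, the conditional probability of the event $\eta(w,t+1)\neq(\tau'\eta(\cdot,t))(w)$, given all $\eta(w',t')$ with $t'\le t$ and all $\eta(w',t+1)$ with $w'\ne w$, is almost surely at most $\varepsilon$. Suppose that almost surely $\eta(w,0)=\zeta'(w,0)$ for all $w\in\mathbb{C}$. Let $r=24$ and suppose $\varepsilon<\frac{1}{32\, r^{8}}$. Then for every $w\in\mathbb{C}$ and every $t\in I$: - if $m=\infty$, then $\mathbf{P}\bigl(\eta(w,t)\ne\zeta'(w,t)\bigr)\le 4r\varepsilon$; - if $m$ is finite, then $$\mathbf{P}\bigl(\eta(w,t)\ne\zeta'(w,t)\bigr)\le 4r\varepsilon+(tN)\cdot 2r\,m^{2}\bigl(2r^{2}\varepsilon^{1/12}\bigr)^{m},$$ where the second summand is read with the convention $0\cdot\infty=0$ when $N=\infty$. 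-/

import Mathlib

open MeasureTheory
open scoped ENNReal

/-! Sites: `ZMod k` is the one-dimensional set of sites with `k` cells for `1 ≤ k`, and
`ZMod 0 = ℤ` is the infinite one. Discrete time is `ℕ`; a space-time configuration on a time
interval `I` is a function `C → ℕ → S` of which only the values at times in `I` matter. -/

/-- The three-dimensional set of sites `ℤ_m × ℤ_m × ℤ_n`, where index `0` stands for `∞`. -/
abbrev Cell (m n : ℕ) : Type := ZMod m × ZMod m × ZMod n

/-- Majority vote of three states. When the three are pairwise distinct there is no majority, and
the outcome is given by an arbitrary tie-breaking function `tie`. -/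
noncomputable def maj {S : Type*} (tie : S → S → S → S) (x y z : S) : S :=
  open Classical in
  if x = y then x else if x = z then x else if y = z then y else tie x y z

/-- One step of the one-dimensional cellular automaton with local rule `trans`. -/
def lineStep {S : Type*} {n : ℕ} (trans : S → S → S → S) (c : ZMod n → S) : ZMod n → S :=
  fun u => trans (c (u - 1)) (c u) (c (u + 1))

/-- One step of Toom's rule: in each plane with fixed third coordinate, every cell takes the
majority of itself and its two neighbors in the positive first and second directions. -/
noncomputable def toomStep {S : Type*} {m n : ℕ} (tie : S → S → S → S) (c : Cell m n → S) :
    Cell m n → S :=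
  fun w => maj tie (c (w.1, w.2.1, w.2.2)) (c (w.1 + 1, w.2.1, w.2.2)) (c (w.1, w.2.1 + 1, w.2.2))

/-- One step of the three-dimensional rule: first Toom's rule in each plane, then the
one-dimensional rule `trans` on each line obtained by fixing the first two coordinates. -/
noncomputable def spaceStep {S : Type*} {m n : ℕ} (trans tie : S → S → S → S)
    (c : Cell m n → S) : Cell m n → S :=
  fun w => lineStep trans (fun u => toomStep tie c (w.1, w.2.1, u)) w.2.2

/-- `ζ` is a trajectory, on the time interval `I`, of the deterministic cellular automaton whose
global transition map is `F`. -/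
def IsTrajectory {C S : Type*} (I : Set ℕ) (F : (C → S) → C → S) (ζ : C → ℕ → S) : Prop :=
  ∀ (x : C) (t : ℕ), t ∈ I → t + 1 ∈ I → ζ x (t + 1) = F (fun y => ζ y t) x

/-- The space-time configuration `(i, j, u, t) ↦ ζ(u, t)`. -/
def planeLift {S : Type*} {n : ℕ} (m : ℕ) (ζ : ZMod n → ℕ → S) : Cell m n → ℕ → S :=
  fun w t => ζ w.2.2 t

/-- The σ-algebra generated by all `η(x', t')` with `t' < t`, or with `t' = t` and `x' ≠ x`. -/
abbrev otherSigma {Ω C S : Type*} [MeasurableSpace S] (I : Set ℕ) (η : Ω → C → ℕ → S)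
    (x : C) (t : ℕ) : MeasurableSpace Ω :=
  ⨆ (p : C × ℕ) (_ : p.2 ∈ I ∧ (p.2 < t ∨ (p.2 = t ∧ p.1 ≠ x))),
    MeasurableSpace.comap (fun ω => η ω p.1 p.2) inferInstance

/-- The random space-time configuration `η` is a trajectory of the `ε`-perturbation of the cellular
automaton with global transition map `F`: at each site and time, the conditional probability of
disobeying the rule, given the whole past and the other sites at the same time, is at most `ε`. -/
structure IsPerturbedTrajectory {Ω C S : Type*} [MeasurableSpace Ω] [MeasurableSpace S]
    (μ : Measure Ω) (I : Set ℕ) (F : (C → S) → C → S) (ε : ℝ) (η : Ω → C → ℕ → S) : Prop where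
  measurable : ∀ (x : C) (t : ℕ), t ∈ I → Measurable fun ω => η ω x t
  noise_le : ∀ (x : C) (t : ℕ), t ∈ I → t + 1 ∈ I →
    μ[Set.indicator {ω | η ω x (t + 1) ≠ F (fun y => η ω y t) x} (fun _ => (1 : ℝ)) |
      otherSigma I η x (t + 1)] ≤ᵐ[μ] fun _ => ε

/-!
An error at a site outside the noise (the set of sites where the rule is disobeyed) comes from a
wrong majority on one of the three lines that the site reads, hence from two errors one time step
earlier among three adjacent voters. The idea is to follow errors back in time and to show that
each of them is *explained* by noise: it lies in a finite connected set `V` of errors, in the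
graph of degree 24 of neighboring space-time sites, with `#V + 3 ≤ 4 n` where `n` is the number of
noise sites in `V`.

With horizontal coordinates `a`, `b` and time `t`, the three functions `-3a - t`, `-3b - t`, `3a +
3b + 2t` have sum zero, and for each of them one of the two erroneous predecessors of an error
increases it by one. Given three poles in a connected family of errors, call the sum of the `i`-th
function at the `i`-th pole, for `i = 0, 1, 2`, their span. One step into the past replaces the
poles by predecessors, increases the span by 3 and costs 3 edges. Simultaneous errors in one
component of the graph may lie over different components of the past; such parts are joined by
horizontal edges ("forks"), one edge for one more component, and a fork decreases the span by at
most 3. A noise site is a set with span `0`. Induction on time therefore yields, for all poles, a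
connected set containing them with `#V + 3 + span ≤ 4 n` (`ToomSystem.explained_component`). As
the span of a single site is `0`, this explains every error.

Any given set of `k` sites is contained in the noise with probability at most `ε ^ k`
(`measure_iInter_noiseEvent_le`). A connected set of `j + 1` points is the support of a closed
walk of length `2 j`, of which there are at most `24 ^ (2 j)`, so a union bound over walks and
over subsets of their supports gives the first term of the bound. When the horizontal plane is a
torus, the argument is carried out on the universal cover. An explanation with `j < m` is mapped
injectively to the torus. If `j ≥ m`, its closed walk is covered by at most `3 j / m` segments of
`m` consecutive points, so that one of them contains at least `m / 12` of the more than `j / 4`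
noise sites; segments are mapped injectively, and the union bound over segments and their starting
points gives the second term.
-/

/-! ### Connected sets and closed walks -/

/-- A finite connected set of vertices is the support of a closed walk (the tour around a spanning
tree) that traverses each of the `#V - 1` edges of the tree twice. -/
theorem SimpleGraph.exists_closed_walk_support_eq {X : Type*} [DecidableEq X] (G : SimpleGraph X)
    {V : Finset X} (hV : (G.induce (V : Set X)).Connected) {v : X} (hv : v ∈ V) :
    ∃ p : G.Walk v v, p.length = 2 * (V.card - 1) ∧ p.support.toFinset = V := by
  have key : ∀ k, k + 1 ≤ V.card → ∃ p : G.Walk v v, p.length = 2 * k ∧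
      p.support.toFinset ⊆ V ∧ p.support.toFinset.card = k + 1 := by
    intro k
    induction k with
    | zero =>
      intro _
      exact ⟨.nil, by simp, by simpa using hv, by simp⟩
    | succ k ih =>
      intro hk
      obtain ⟨p, hlen, hsub, hcard⟩ := ih (by omega)
      obtain ⟨z, hzV, hz⟩ : ∃ z ∈ V, z ∉ p.support.toFinset :=
        Finset.exists_mem_notMem_of_card_lt_card (by omega)
      obtain ⟨w⟩ := hV.preconnected ⟨v, hv⟩ ⟨z, hzV⟩
      obtain ⟨d, -, hd1, hd2⟩ := w.exists_boundary_dart {x | (x : X) ∈ p.support}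
        (by simp) (by simpa using hz)
      obtain ⟨⟨⟨x, hx⟩, ⟨y, hy⟩⟩, hadj⟩ := d
      have hxy : G.Adj x y := hadj
      replace hd1 : x ∈ p.support := hd1
      replace hd2 : y ∉ p.support := hd2
      let q := (p.takeUntil x hd1).append (.cons hxy (.cons hxy.symm (p.dropUntil x hd1)))
      have hsupp : q.support.toFinset = insert y p.support.toFinset := by
        ext a
        have h1 : a ∈ p.support ↔
            a ∈ (p.takeUntil x hd1).support ∨ a ∈ (p.dropUntil x hd1).support := by
          rw [← SimpleGraph.Walk.mem_support_append_iff, p.take_spec hd1]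
        have h2 : x ∈ (p.takeUntil x hd1).support := SimpleGraph.Walk.end_mem_support _
        simp only [q, List.mem_toFinset, SimpleGraph.Walk.mem_support_append_iff,
          SimpleGraph.Walk.support_cons, List.mem_cons, Finset.mem_insert, h1]
        constructor
        · rintro (h | rfl | h | h) <;> simp_all
        · rintro (h | h | h) <;> simp_all
      refine ⟨q, ?_, ?_, ?_⟩
      · have := congrArg SimpleGraph.Walk.length (p.take_spec hd1)
        simp only [SimpleGraph.Walk.length_append] at this
        simp only [q, SimpleGraph.Walk.length_append, SimpleGraph.Walk.length_cons]
        omega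
      · rw [hsupp]
        exact Finset.insert_subset hy hsub
      · rw [hsupp, Finset.card_insert_of_notMem (by simpa using hd2), hcard]
  have hpos : 0 < V.card := Finset.card_pos.2 ⟨v, hv⟩
  obtain ⟨p, h1, h2, h3⟩ := key (V.card - 1) (by omega)
  exact ⟨p, h1, Finset.eq_of_subset_of_card_le h2 (by omega)⟩

/-! ### Explanation trees -/

/-- The combinatorial data on which the explanation of an error rests: a graph of space-time sites,
a set `err` of erroneous sites and a set `noise` of sites at which the rule was disobeyed. There are
three "heights" with sum zero; an erroneous site `p` outside the noise has, for each `i`, an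
erroneous neighbor `child p i` one time step earlier whose `i`-th height is larger by one, and these
three (of which in practice only two are distinct) coincide or are adjacent. -/
structure ToomSystem (X : Type*) where
  /-- adjacency of space-time sites -/
  graph : SimpleGraph X
  /-- the time coordinate -/
  time : X → ℕ
  /-- the three heights -/
  height : Fin 3 → X → ℤ
  /-- the erroneous sites -/
  err : Set X
  /-- the sites at which the rule was disobeyed -/
  noise : Set X
  /-- the erroneous predecessor that increases a given height -/
  child : X → Fin 3 → X
  sum_height : ∀ p, ∑ i, height i p = 0
  fork_height : ∀ p ∈ err, ∀ q ∈ err, graph.Adj p q → time p = time q →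
    ∀ s : Fin 3 → X, (∀ i, s i = p ∨ s i = q) → -3 ≤ ∑ i, height i (s i)
  child_err : ∀ p ∈ err, p ∉ noise → ∀ i, child p i ∈ err
  child_time : ∀ p ∈ err, p ∉ noise → ∀ i, time (child p i) + 1 = time p
  child_adj : ∀ p ∈ err, p ∉ noise → ∀ i, graph.Adj (child p i) p
  child_height : ∀ p ∈ err, p ∉ noise → ∀ i, height i (child p i) = height i p + 1
  child_fork : ∀ p ∈ err, p ∉ noise → ∀ i j,
    child p i = child p j ∨ graph.Adj (child p i) (child p j)

namespace ToomSystem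

variable {X : Type*} (T : ToomSystem X)

/-- Two errors at times before `t` are linked if they are adjacent and simultaneous, or if one of
them is a chosen predecessor of the other. -/
def Link (t : ℕ) (x y : X) : Prop :=
  (x ∈ T.err ∧ T.time x < t) ∧ (y ∈ T.err ∧ T.time y < t) ∧
    ((T.graph.Adj x y ∧ T.time x = T.time y) ∨
      (x ∉ T.noise ∧ ∃ i, y = T.child x i) ∨ (y ∉ T.noise ∧ ∃ i, x = T.child y i))

/-- Two sites are connected by links among errors at times before `t`. -/
def Reach (t : ℕ) : X → X → Prop := Relation.ReflTransGen (T.Link t)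

open Classical in
/-- Every choice of three poles in `S` is contained in a finite connected subset `V` of `D` that has
many noise sites: if `n` is their number, then `#V - 1` is at most `4 (n - 1)` minus the span of the
poles, that is, the sum of the `i`-th heights of the `i`-th poles. -/
def Explained (S D : Set X) : Prop :=
  ∀ v : Fin 3 → X, (∀ i, v i ∈ S) → ∃ V : Finset X, (V : Set X) ⊆ D ∧ (∀ i, v i ∈ V) ∧
    (T.graph.induce (V : Set X)).Connected ∧
    (V.card : ℤ) + 3 + ∑ i, T.height i (v i) ≤ 4 * ({x ∈ V | x ∈ T.noise}.card : ℤ)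

variable {T}

theorem Link.symm {t : ℕ} {x y : X} (h : T.Link t x y) : T.Link t y x := by
  obtain ⟨hx, hy, h | h | h⟩ := h
  · exact ⟨hy, hx, .inl ⟨h.1.symm, h.2.symm⟩⟩
  · exact ⟨hy, hx, .inr (.inr h)⟩
  · exact ⟨hy, hx, .inr (.inl h)⟩

theorem Link.mono {s t : ℕ} (hst : s ≤ t) {x y : X} (h : T.Link s x y) : T.Link t x y :=
  ⟨⟨h.1.1, h.1.2.trans_le hst⟩, ⟨h.2.1.1, h.2.1.2.trans_le hst⟩, h.2.2⟩

theorem Reach.symm {t : ℕ} {x y : X} (h : T.Reach t x y) : T.Reach t y x :=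
  have : Std.Symm (T.Link t) := ⟨fun _ _ => Link.symm⟩
  Relation.ReflTransGen.stdSymm.symm _ _ h

theorem Reach.trans {t : ℕ} {x y z : X} (h : T.Reach t x y) (h' : T.Reach t y z) : T.Reach t x z :=
  Relation.ReflTransGen.trans h h'

theorem Reach.mono {s t : ℕ} (hst : s ≤ t) {x y : X} (h : T.Reach s x y) : T.Reach t x y :=
  Relation.ReflTransGen.mono (fun _ _ => Link.mono hst) _ _ h

theorem Link.reach {t : ℕ} {x y : X} (h : T.Link t x y) : T.Reach t x y :=
  Relation.ReflTransGen.single h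

theorem Reach.mem_err {t : ℕ} {x y : X} (h : T.Reach t x y) (hx : x ∈ T.err ∧ T.time x < t) :
    y ∈ T.err ∧ T.time y < t := by
  rcases Relation.ReflTransGen.cases_tail h with rfl | ⟨z, -, hz⟩
  · exact hx
  · exact hz.2.1

theorem link_child {t : ℕ} {p : X} (hp : p ∈ T.err) (hn : p ∉ T.noise) (ht : T.time p < t)
    (i : Fin 3) : T.Link t p (T.child p i) :=
  ⟨⟨hp, ht⟩, ⟨T.child_err p hp hn i, by have := T.child_time p hp hn i; omega⟩,
    .inr (.inl ⟨hn, i, rfl⟩)⟩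

theorem reach_child {t : ℕ} {p : X} (hp : p ∈ T.err) (hn : p ∉ T.noise) (ht : T.time p ≤ t)
    (i j : Fin 3) : T.Reach t (T.child p i) (T.child p j) := by
  rcases T.child_fork p hp hn i j with h | h
  · rw [h]; exact Relation.ReflTransGen.refl
  · have hi := T.child_time p hp hn i
    have hj := T.child_time p hp hn j
    exact Link.reach ⟨⟨T.child_err p hp hn i, by omega⟩, ⟨T.child_err p hp hn j, by omega⟩,
      .inl ⟨h, by omega⟩⟩

theorem explained_singleton {x : X} (hx : x ∈ T.noise) : T.Explained {x} {x} := by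
  classical
  intro v hv
  refine ⟨{x}, by simp, fun i => by simpa using hv i, ?_, ?_⟩
  · rw [Finset.coe_singleton]
    exact ⟨fun a b => by rw [Subsingleton.elim a b]⟩
  · have : ∀ i, v i = x := fun i => hv i
    simp [this, T.sum_height, Finset.filter_singleton, hx]

/-- Two explained sets with disjoint territories may be joined by a fork, an edge between
simultaneous errors `p` and `q`. Each side keeps its own poles and takes its endpoint of the fork
as a substitute for the others. This loses at most `3` of the sum of the spans, by `fork_height`,
which is the `3` that one tree saves over two. -/
theorem Explained.join {S D S' D' : Set X} (h : T.Explained S D) (h' : T.Explained S' D')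
    (hD : Disjoint D D') {p q : X} (hp : p ∈ S) (hq : q ∈ S') (hpe : p ∈ T.err)
    (hqe : q ∈ T.err) (hpq : T.graph.Adj p q) (ht : T.time p = T.time q) : T.Explained (S ∪ S') (D ∪ D') := by
  classical
  intro v hv
  by_cases hS : ∀ i, v i ∈ S
  · obtain ⟨V, h1, h2⟩ := h v hS
    exact ⟨V, h1.trans Set.subset_union_left, h2⟩
  by_cases hS' : ∀ i, v i ∈ S'
  · obtain ⟨V, h1, h2⟩ := h' v hS'
    exact ⟨V, h1.trans Set.subset_union_right, h2⟩
  push Not at hS hS'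
  obtain ⟨i₀, hi₀⟩ := hS
  obtain ⟨i₁, hi₁⟩ := hS'
  have hi₁S : v i₁ ∈ S := (hv i₁).resolve_right hi₁
  -- A pole on the other side of the fork is replaced by the endpoint of the fork on this side.
  obtain ⟨V, hV, hvV, hVc, hVn⟩ := h (fun i => if v i ∈ S then v i else p)
    (fun i => by split_ifs <;> assumption)
  obtain ⟨W, hW, hvW, hWc, hWn⟩ := h' (fun i => if v i ∈ S then q else v i)
    (fun i => by
      split_ifs with hi
      · exact hq
      · exact (hv i).resolve_left hi)
  have hpV : p ∈ V := by simpa [hi₀] using hvV i₀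
  have hqW : q ∈ W := by simpa [hi₁S] using hvW i₁
  have hVW : Disjoint V W := by
    rw [← Finset.disjoint_coe]
    exact hD.mono hV hW
  refine ⟨V ∪ W, ?_, fun i => ?_, ?_, ?_⟩
  · rw [Finset.coe_union]
    exact Set.union_subset_union hV hW
  · have h1 := hvV i
    have h2 := hvW i
    by_cases hi : v i ∈ S
    · rw [if_pos hi] at h1
      exact Finset.mem_union_left _ h1
    · rw [if_neg hi] at h2
      exact Finset.mem_union_right _ h2
  · rw [Finset.coe_union]
    exact SimpleGraph.connected_induce_union hVc.preconnected hWc.preconnected hpV hqW hpq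
  · have hs := T.fork_height p hpe q hqe hpq ht (fun i => if v i ∈ S then q else p)
      (fun i => by split_ifs <;> simp)
    have hsum : ∑ i, T.height i (if v i ∈ S then v i else p) +
        ∑ i, T.height i (if v i ∈ S then q else v i) =
        ∑ i, T.height i (v i) + ∑ i, T.height i (if v i ∈ S then q else p) := by
      rw [← Finset.sum_add_distrib, ← Finset.sum_add_distrib]
      refine Finset.sum_congr rfl fun i _ => ?_
      split_ifs <;> ring
    rw [Finset.card_union_of_disjoint hVW, Finset.filter_union,
      Finset.card_union_of_disjoint (Finset.disjoint_filter_filter hVW)]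
    push_cast
    linarith

/-- Going up one time step: each of the three poles has a predecessor in `S` which increases its
height, so that three new edges are paid for by the decrease of the span by three. -/
theorem Explained.ascend {S D S' : Set X} (h : T.Explained S D)
    (hS' : ∀ p ∈ S', p ∈ T.err ∧ p ∉ T.noise ∧ ∀ i, T.child p i ∈ S) :
    T.Explained S' (S' ∪ D) := by
  classical
  intro v hv
  obtain ⟨V, hV, hvV, hVc, hVn⟩ := h (fun i => T.child (v i) i) fun i => (hS' _ (hv i)).2.2 i
  have hheight : ∑ i, T.height i (T.child (v i) i) = ∑ i, T.height i (v i) + 3 := by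
    rw [Finset.sum_congr rfl fun i _ =>
      T.child_height (v i) (hS' _ (hv i)).1 (hS' _ (hv i)).2.1 i, Finset.sum_add_distrib]
    simp
  have hattach : ∀ (W : Finset X) (x y : X), (T.graph.induce (W : Set X)).Connected → x ∈ W →
      T.graph.Adj x y → (T.graph.induce ((insert y W : Finset X) : Set X)).Connected := by
    intro W x y hW hx hxy
    rw [Finset.coe_insert, Set.insert_eq, Set.union_comm]
    refine SimpleGraph.connected_induce_union hW.preconnected ?_ hx (Set.mem_singleton y) hxy
    exact fun a b => by rw [Subsingleton.elim a b]
  have hadj : ∀ i, T.graph.Adj (T.child (v i) i) (v i) := fun i =>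
    T.child_adj (v i) (hS' _ (hv i)).1 (hS' _ (hv i)).2.1 i
  refine ⟨insert (v 0) (insert (v 1) (insert (v 2) V)), ?_, ?_, ?_, ?_⟩
  · simp only [Finset.coe_insert, Set.insert_subset_iff]
    exact ⟨.inl (hv 0), .inl (hv 1), .inl (hv 2), hV.trans Set.subset_union_right⟩
  · intro i
    fin_cases i <;> simp
  · refine hattach _ _ _ (hattach _ _ _ (hattach _ _ _ hVc (hvV 2) (hadj 2)) ?_ (hadj 1)) ?_
      (hadj 0)
    · exact Finset.mem_insert_of_mem (hvV 1)
    · exact Finset.mem_insert_of_mem (Finset.mem_insert_of_mem (hvV 0))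
  · have hc : (insert (v 0) (insert (v 1) (insert (v 2) V))).card ≤ V.card + 3 :=
      (Finset.card_insert_le _ _).trans (Nat.succ_le_succ ((Finset.card_insert_le _ _).trans
        (Nat.succ_le_succ (Finset.card_insert_le _ _))))
    have hn : ({x ∈ V | x ∈ T.noise}).card ≤
        ({x ∈ insert (v 0) (insert (v 1) (insert (v 2) V)) | x ∈ T.noise}).card := by
      refine Finset.card_le_card (Finset.filter_subset_filter _ ?_)
      exact fun x hx => by simp [hx]
    zify at hc hn
    linarith

variable (T) in
/-- The part of space-time explained by a set `S` of errors at time `t`: `S` itself and the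
components, among the errors before time `t`, of the predecessors of its elements. -/
def below (t : ℕ) (S : Set X) : Set X :=
  S ∪ {z | ∃ y ∈ S, y ∉ T.noise ∧ T.Reach t (T.child y 0) z}

variable (T) in
/-- Sets of errors at time `t` that contain with each error outside the noise all others whose
predecessors lie in the same component of the past. -/
def Saturated (t : ℕ) (S : Set X) : Prop :=
  (∀ y ∈ S, y ∈ T.err ∧ T.time y = t) ∧
    ∀ y ∈ S, y ∉ T.noise → ∀ z ∈ T.err, z ∉ T.noise → T.time z = t →
      T.Reach t (T.child y 0) (T.child z 0) → z ∈ S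

theorem time_lt_of_mem_past {t : ℕ} {S : Set X} (hS : ∀ y ∈ S, y ∈ T.err ∧ T.time y = t) {y z : X}
    (hy : y ∈ S) (hn : y ∉ T.noise) (h : T.Reach t (T.child y 0) z) : T.time z < t := by
  have := T.child_time y (hS y hy).1 hn 0
  exact (h.mem_err ⟨T.child_err y (hS y hy).1 hn 0, by have := (hS y hy).2; omega⟩).2

theorem Saturated.disjoint_below {t : ℕ} {S S' : Set X} (hS : T.Saturated t S)
    (hS' : ∀ y ∈ S', y ∈ T.err ∧ T.time y = t) (h : Disjoint S S') :
    Disjoint (T.below t S) (T.below t S') := by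
  rw [Set.disjoint_left] at h ⊢
  rintro z (hz | ⟨y, hy, hyn, hyz⟩) (hz' | ⟨y', hy', hyn', hyz'⟩)
  · exact h hz hz'
  · have := time_lt_of_mem_past hS' hy' hyn' hyz'
    have := (hS.1 z hz).2
    omega
  · have := time_lt_of_mem_past hS.1 hy hyn hyz
    have := (hS' z hz').2
    omega
  · exact h (hS.2 y hy hyn y' (hS' y' hy').1 hyn' (hS' y' hy').2 (hyz.trans hyz'.symm)) hy'

variable (T) in
/-- The smallest saturated set of errors at time `t` containing `x`. -/
def cluster (t : ℕ) (x : X) : Set X :=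
  {y | y = x ∨ (x ∉ T.noise ∧ y ∈ T.err ∧ y ∉ T.noise ∧ T.time y = t ∧
    T.Reach t (T.child x 0) (T.child y 0))}

theorem saturated_cluster {t : ℕ} {x : X} (hx : x ∈ T.err) (ht : T.time x = t) :
    T.Saturated t (T.cluster t x) := by
  refine ⟨?_, ?_⟩
  · rintro y (rfl | h)
    · exact ⟨hx, ht⟩
    · exact ⟨h.2.1, h.2.2.2.1⟩
  · rintro y (rfl | h) hyn z hz hzn hzt hyz
    · exact .inr ⟨hyn, hz, hzn, hzt, hyz⟩
    · exact .inr ⟨h.1, hz, hzn, hzt, h.2.2.2.2.trans hyz⟩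

/-- A saturated set that meets a cluster contains the error that generates it. -/
theorem Saturated.disjoint_cluster {t : ℕ} {S : Set X} (hS : T.Saturated t S) {x : X}
    (hx : x ∈ T.err) (ht : T.time x = t) (hxS : x ∉ S) : Disjoint S (T.cluster t x) := by
  rw [Set.disjoint_left]
  rintro y hy (rfl | h)
  · exact hxS hy
  · exact hxS (hS.2 y hy h.2.2.1 x hx h.1 ht h.2.2.2.2.symm)

theorem Saturated.union {t : ℕ} {S S' : Set X} (hS : T.Saturated t S) (hS' : T.Saturated t S') :
    T.Saturated t (S ∪ S') := by
  refine ⟨?_, ?_⟩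
  · rintro y (hy | hy)
    exacts [hS.1 y hy, hS'.1 y hy]
  · rintro y (hy | hy) hyn z hz hzn hzt hyz
    exacts [.inl (hS.2 y hy hyn z hz hzn hzt hyz), .inr (hS'.2 y hy hyn z hz hzn hzt hyz)]

theorem below_union (t : ℕ) (S S' : Set X) :
    T.below t (S ∪ S') = T.below t S ∪ T.below t S' := by
  ext z
  simp only [below, Set.mem_union, Set.mem_ofPred_eq, or_and_right, exists_or]
  exact or_or_or_comm

theorem explained_cluster {t : ℕ} {x : X} (hx : x ∈ T.err) (ht : T.time x = t)
    (ih : ∀ y ∈ T.err, T.time y + 1 = t →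
      T.Explained {z | T.Reach t y z ∧ T.time z + 1 = t} {z | T.Reach t y z}) :
    T.Explained (T.cluster t x) (T.below t (T.cluster t x)) := by
  by_cases hn : x ∈ T.noise
  · have h1 : T.cluster t x = {x} := by
      ext y
      simp [cluster, hn]
    have h2 : T.below t {x} = {x} := by
      ext y
      simp [below, hn]
    rw [h1, h2]
    exact explained_singleton hn
  · have hct := T.child_time x hx hn 0
    have h := (ih (T.child x 0) (T.child_err x hx hn 0) (by omega)).ascend (S' := T.cluster t x) ?_
    · intro v hv
      obtain ⟨V, hV, h'⟩ := h v hv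
      refine ⟨V, hV.trans (Set.union_subset_union_right _ ?_), h'⟩
      intro z hz
      exact ⟨x, .inl rfl, hn, hz⟩
    · rintro y (rfl | ⟨-, hy, hyn, hyt, hxy⟩)
      · refine ⟨hx, hn, fun i => ⟨reach_child hx hn ht.le 0 i, ?_⟩⟩
        rw [T.child_time y hx hn i, ht]
      · refine ⟨hy, hyn, fun i => ⟨hxy.trans (reach_child hy hyn hyt.le 0 i), ?_⟩⟩
        rw [T.child_time y hy hyn i, hyt]

/-- Every component of the errors up to time `t` is explained. The proof builds up the part of the
component at time `t` cluster by cluster, joining a new cluster to the former ones by a fork. -/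
theorem explained_component (t : ℕ) : ∀ x ∈ T.err, T.time x = t →
    T.Explained {z | T.Reach (t + 1) x z ∧ T.time z = t} {z | T.Reach (t + 1) x z} := by
  induction t using Nat.strong_induction_on with
  | _ t ih =>
  intro x hx ht
  have ih' : ∀ y ∈ T.err, T.time y + 1 = t →
      T.Explained {z | T.Reach t y z ∧ T.time z + 1 = t} {z | T.Reach t y z} := by
    rintro y hy rfl
    simpa using ih (T.time y) (by omega) y hy rfl
  have hcluster : ∀ y, y ∈ T.err → T.time y = t → T.Reach (t + 1) x y →
      T.cluster t y ⊆ {z | T.Reach (t + 1) x z} := by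
    rintro y hy hyt hxy z (rfl | ⟨hyn, hz, hzn, hzt, hyz⟩)
    · exact hxy
    · exact hxy.trans ((link_child hy hyn (by omega) 0).reach.trans
        ((hyz.mono (by omega)).trans (link_child hz hzn (by omega) 0).symm.reach))
  have grow : ∀ (S : Set X), T.Saturated t S → S ⊆ {z | T.Reach (t + 1) x z} → x ∈ S →
      T.Explained S (T.below t S) → ∀ y, T.Reach (t + 1) x y →
      ∃ S', S ⊆ S' ∧ T.Saturated t S' ∧ S' ⊆ {z | T.Reach (t + 1) x z} ∧
        T.Explained S' (T.below t S') ∧ y ∈ T.below t S' := by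
    intro S hS hSx hxS hSe y hxy
    induction hxy with
    | refl => exact ⟨S, subset_rfl, hS, hSx, hSe, .inl hxS⟩
    | @tail y z hxy hyz ih'' =>
      obtain ⟨S', hSS', hS', hSx', hSe', hy⟩ := ih''
      have hxz : T.Reach (t + 1) x z := hxy.trans hyz.reach
      by_cases hz : z ∈ T.below t S'
      · exact ⟨S', hSS', hS', hSx', hSe', hz⟩
      obtain ⟨⟨hye, hyt⟩, ⟨hze, hzt⟩, hlink⟩ := hyz
      have hzt' : T.time z = t := by
        by_contra hne
        apply hz
        rcases hy with hy | ⟨w, hw, hwn, hwy⟩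
        · have hyt' := (hS'.1 y hy).2
          rcases hlink with h | ⟨hn, i, rfl⟩ | ⟨hn, i, rfl⟩
          · omega
          · exact .inr ⟨y, hy, hn, reach_child hye hn hyt'.le 0 i⟩
          · have := T.child_time z hze hn i
            omega
        · have hyt' := time_lt_of_mem_past hS'.1 hw hwn hwy
          exact .inr ⟨w, hw, hwn, hwy.tail ⟨⟨hye, hyt'⟩, ⟨hze, by omega⟩, hlink⟩⟩
      rcases hy with hy | ⟨w, hw, hwn, hwy⟩
      · have hyt' := (hS'.1 y hy).2
        have hadj : T.graph.Adj y z := by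
          rcases hlink with h | ⟨hn, i, rfl⟩ | ⟨hn, i, rfl⟩
          · exact h.1
          · have := T.child_time y hye hn i
            omega
          · have := T.child_time z hze hn i
            omega
        refine ⟨S' ∪ T.cluster t z, hSS'.trans Set.subset_union_left,
          hS'.union (saturated_cluster hze hzt'), Set.union_subset hSx' (hcluster z hze hzt' hxz),
          ?_, .inl (.inr (.inl rfl))⟩
        rw [below_union]
        have hdisj := hS'.disjoint_cluster hze hzt' (fun h => hz (.inl h))
        exact hSe'.join (explained_cluster hze hzt' ih')
          (hS'.disjoint_below (saturated_cluster hze hzt').1 hdisj) hy (.inl rfl) hye hze hadj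
          (by omega)
      · exfalso
        have hyt' := time_lt_of_mem_past hS'.1 hw hwn hwy
        rcases hlink with h | ⟨hn, i, rfl⟩ | ⟨hn, i, rfl⟩
        · omega
        · have := T.child_time y hye hn i
          omega
        · exact hz (.inl (hS'.2 w hw hwn z hze hn hzt'
            (hwy.trans (reach_child hze hn hzt'.le i 0))))
  have hpast : ∀ S : Set X, T.Saturated t S → S ⊆ {z | T.Reach (t + 1) x z} →
      T.below t S ⊆ {z | T.Reach (t + 1) x z} := by
    rintro S hS hSx z (hz | ⟨y, hy, hyn, hyz⟩)
    · exact hSx hz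
    · have hyt := (hS.1 y hy).2
      exact (hSx hy).trans ((link_child (hS.1 y hy).1 hyn (by omega) 0).reach.trans
        (hyz.mono (by omega)))
  have hmem : ∀ S : Set X, T.Saturated t S → ∀ y, T.time y = t → y ∈ T.below t S → y ∈ S := by
    rintro S hS y hyt (hy | ⟨w, hw, hwn, hwy⟩)
    · exact hy
    · have := time_lt_of_mem_past hS.1 hw hwn hwy
      omega
  intro v hv
  have hx0 : T.Reach (t + 1) x x := Relation.ReflTransGen.refl
  obtain ⟨S₀, hS₀, h₀, h₀x, h₀e, hv₀⟩ := grow (T.cluster t x) (saturated_cluster hx ht)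
    (hcluster x hx ht hx0) (.inl rfl) (explained_cluster hx ht ih') (v 0) (hv 0).1
  obtain ⟨S₁, hS₁, h₁, h₁x, h₁e, hv₁⟩ := grow S₀ h₀ h₀x (hS₀ (.inl rfl)) h₀e (v 1) (hv 1).1
  obtain ⟨S₂, hS₂, h₂, h₂x, h₂e, hv₂⟩ := grow S₁ h₁ h₁x (hS₁ (hS₀ (.inl rfl))) h₁e (v 2) (hv 2).1
  obtain ⟨V, hV, hV'⟩ := h₂e v (fun i => by
    fin_cases i
    · exact hS₂ (hS₁ (hmem S₀ h₀ _ (hv 0).2 hv₀))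
    · exact hS₂ (hmem S₁ h₁ _ (hv 1).2 hv₁)
    · exact hmem S₂ h₂ _ (hv 2).2 hv₂)
  exact ⟨V, hV.trans (hpast S₂ h₂ h₂x), hV'⟩

/-- Every error lies in a finite connected set of errors in which the noise has density more than
one quarter. -/
theorem exists_explanation {x : X} (hx : x ∈ T.err) :
    ∃ V : Finset X, x ∈ V ∧ (V : Set X) ⊆ T.err ∧ (T.graph.induce (V : Set X)).Connected ∧
      ∃ A ⊆ V, V.card + 3 ≤ 4 * A.card ∧ ∀ y ∈ A, y ∈ T.noise := by
  classical
  obtain ⟨V, hV, hvV, hVc, hVn⟩ := explained_component (T.time x) x hx rfl (fun _ => x)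
    (fun _ => ⟨Relation.ReflTransGen.refl, rfl⟩)
  refine ⟨V, hvV 0, fun z hz => ((hV hz).mem_err ⟨hx, Nat.lt_succ_self _⟩).1, hVc, _,
    Finset.filter_subset _ _, ?_, fun y hy => (Finset.mem_filter.1 hy).2⟩
  rw [T.sum_height] at hVn
  zify
  linarith

end ToomSystem

/-! ### Space-time sites and walks -/

/-- The 24 displacements `(a, b, u, t)` between neighboring space-time sites: the nine from a site
to those on which it depends, their opposites, and the six between two sites `(a, b)`, `(a + 1, b)`,
`(a, b + 1)` whose majority is formed. -/
def moves : Finset (ℤ × ℤ × ℤ × ℤ) :=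
  {(0, 0, -1, -1), (0, 0, 0, -1), (0, 0, 1, -1), (1, 0, -1, -1), (1, 0, 0, -1), (1, 0, 1, -1),
    (0, 1, -1, -1), (0, 1, 0, -1), (0, 1, 1, -1),
    (0, 0, 1, 1), (0, 0, 0, 1), (0, 0, -1, 1), (-1, 0, 1, 1), (-1, 0, 0, 1), (-1, 0, -1, 1),
    (0, -1, 1, 1), (0, -1, 0, 1), (0, -1, -1, 1),
    (1, 0, 0, 0), (-1, 0, 0, 0), (0, 1, 0, 0), (0, -1, 0, 0), (1, -1, 0, 0), (-1, 1, 0, 0)}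

theorem card_moves : moves.card = 24 := by decide

theorem neg_mem_moves : ∀ d ∈ moves, -d ∈ moves := by decide

theorem abs_le_one_of_mem_moves : ∀ d ∈ moves, |d.1| ≤ 1 ∧ |d.2.1| ≤ 1 := by decide

theorem horizontal_of_mem_moves : ∀ d ∈ moves, d.2.2.2 = 0 →
    |d.1| ≤ 1 ∧ |d.2.1| ≤ 1 ∧ |d.1 + d.2.1| ≤ 1 ∧ ¬(d.1 = 0 ∧ d.2.1 = 0) := by decide

/-- Translation of a space-time site by an integer vector. The two horizontal coordinates live in
`ℤ` or in `ℤ_m`. -/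
def shift {α : Type*} [Ring α] {n : ℕ} (q : α × α × ZMod n × ℤ) (d : ℤ × ℤ × ℤ × ℤ) :
    α × α × ZMod n × ℤ :=
  (q.1 + d.1, q.2.1 + d.2.1, q.2.2.1 + d.2.2.1, q.2.2.2 + d.2.2.2)

theorem shift_shift_neg {α : Type*} [Ring α] {n : ℕ} (q : α × α × ZMod n × ℤ)
    (d : ℤ × ℤ × ℤ × ℤ) : shift (shift q d) (-d) = q := by
  simp [shift]

/-- The neighborhood graph of space-time with the horizontal coordinates unwrapped. -/
def siteGraph (n : ℕ) : SimpleGraph (ℤ × ℤ × ZMod n × ℤ) where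
  Adj p q := ∃ d ∈ moves, q = shift p d
  symm := ⟨by
    rintro p _ ⟨d, hd, rfl⟩
    exact ⟨-d, neg_mem_moves d hd, (shift_shift_neg p d).symm⟩⟩
  loopless := ⟨by
    rintro p ⟨d, hd, h⟩
    simp only [shift, Prod.ext_iff, Int.cast_id] at h
    exact (horizontal_of_mem_moves d hd (by omega)).2.2.2 ⟨by omega, by omega⟩⟩

/-- Reduction of the horizontal coordinates modulo `m`. -/
def wrap (m : ℕ) {n : ℕ} (p : ℤ × ℤ × ZMod n × ℤ) : ZMod m × ZMod m × ZMod n × ℤ :=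
  ((p.1 : ZMod m), (p.2.1 : ZMod m), p.2.2)

theorem wrap_shift (m : ℕ) {n : ℕ} (p : ℤ × ℤ × ZMod n × ℤ) (d : ℤ × ℤ × ℤ × ℤ) :
    wrap m (shift p d) = shift (wrap m p) d := by
  simp [wrap, shift]

theorem wrap_surjective (m n : ℕ) : Function.Surjective (wrap m (n := n)) := by
  rintro ⟨a, b, u⟩
  obtain ⟨a', rfl⟩ := ZMod.intCast_surjective a
  obtain ⟨b', rfl⟩ := ZMod.intCast_surjective b
  exact ⟨(a', b', u), rfl⟩

theorem eq_of_intCast_eq_of_abs_lt {m : ℕ} {a b : ℤ} (h : (a : ZMod m) = b)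
    (hm : m = 0 ∨ |a - b| < m) : a = b := by
  have hdvd : (m : ℤ) ∣ b - a := (ZMod.intCast_eq_intCast_iff_dvd_sub _ _ _).1 h
  rcases hm with rfl | hm
  · simp only [Nat.cast_zero, zero_dvd_iff] at hdvd
    omega
  · have := Int.eq_zero_of_abs_lt_dvd hdvd (by rwa [abs_sub_comm])
    omega

theorem eq_of_wrap_eq {m n : ℕ} {p q : ℤ × ℤ × ZMod n × ℤ} (h : wrap m p = wrap m q)
    (hm : m = 0 ∨ (|p.1 - q.1| < m ∧ |p.2.1 - q.2.1| < m)) : p = q := by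
  simp only [wrap, Prod.ext_iff] at h
  refine Prod.ext (eq_of_intCast_eq_of_abs_lt h.1 (hm.imp_right And.left))
    (Prod.ext (eq_of_intCast_eq_of_abs_lt h.2.1 (hm.imp_right And.right)) (Prod.ext h.2.2.1 h.2.2.2))

theorem abs_sub_le_of_walk {n : ℕ} {f : ℕ → ℤ × ℤ × ZMod n × ℤ} {L : ℕ}
    (hf : ∀ i < L, (siteGraph n).Adj (f i) (f (i + 1))) (i k : ℕ) (hik : i + k ≤ L) :
    |(f (i + k)).1 - (f i).1| ≤ k ∧ |(f (i + k)).2.1 - (f i).2.1| ≤ k := by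
  induction k with
  | zero => simp
  | succ k ih =>
    obtain ⟨h1, h2⟩ := ih (by omega)
    obtain ⟨d, hd, h⟩ := hf (i + k) (by omega)
    obtain ⟨h3, h4⟩ := abs_le_one_of_mem_moves d hd
    rw [← add_assoc, h]
    simp only [shift, Int.cast_id, abs_le] at *
    push_cast
    constructor <;> constructor <;> omega

/-- The supports of the walks of length `L` starting at `q`. -/
def walkSupports {m n : ℕ} :
    ℕ → ZMod m × ZMod m × ZMod n × ℤ → Finset (Finset (ZMod m × ZMod m × ZMod n × ℤ))
  | 0, q => {{q}}
  | L + 1, q => moves.biUnion fun d => (walkSupports L (shift q d)).image (insert q)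

theorem card_walkSupports_le {m n : ℕ} (L : ℕ) (q : ZMod m × ZMod m × ZMod n × ℤ) :
    (walkSupports L q).card ≤ 24 ^ L := by
  induction L generalizing q with
  | zero => simp [walkSupports]
  | succ L ih =>
    rw [walkSupports, pow_succ', ← card_moves]
    exact Finset.card_biUnion_le_card_mul _ _ _ fun d _ => Finset.card_image_le.trans
      (card_moves ▸ ih _)

theorem card_le_of_mem_walkSupports {m n : ℕ} {L : ℕ} {q : ZMod m × ZMod m × ZMod n × ℤ}
    {W : Finset (ZMod m × ZMod m × ZMod n × ℤ)} (hW : W ∈ walkSupports L q) : W.card ≤ L + 1 := by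
  induction L generalizing q W with
  | zero =>
    rw [walkSupports, Finset.mem_singleton] at hW
    simp [hW]
  | succ L ih =>
    simp only [walkSupports, Finset.mem_biUnion, Finset.mem_image] at hW
    obtain ⟨d, -, W', hW', rfl⟩ := hW
    exact (Finset.card_insert_le _ _).trans (Nat.succ_le_succ (ih hW'))

theorem image_mem_walkSupports (m : ℕ) {n L : ℕ} {f : ℕ → ℤ × ℤ × ZMod n × ℤ}
    (hf : ∀ i < L, (siteGraph n).Adj (f i) (f (i + 1))) :
    (Finset.range (L + 1)).image (fun i => wrap m (f i)) ∈ walkSupports L (wrap m (f 0)) := by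
  induction L generalizing f with
  | zero => simp [walkSupports]
  | succ L ih =>
    obtain ⟨d, hd, h⟩ := hf 0 (by omega)
    simp only [walkSupports, Finset.mem_biUnion, Finset.mem_image]
    refine ⟨d, hd, (Finset.range (L + 1)).image fun i => wrap m (f (i + 1)), ?_, ?_⟩
    · rw [← wrap_shift, ← h]
      exact ih (f := fun i => f (i + 1)) fun i hi => hf (i + 1) (by omega)
    · rw [Finset.range_add_one' (L + 1), Finset.image_insert]
      rw [Finset.map_eq_image, Finset.image_image]
      rfl

/-- If a set `A` of more than `j / 4` points lies on a walk of length `2 j`, then some segment of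
`m ≤ j` consecutive points contains at least `m / 12` of them: the walk is covered by at most
`3 j / m` segments. -/
theorem exists_segment_card_le {X : Type*} [DecidableEq X] {f : ℕ → X} {j m : ℕ} {A : Finset X}
    (hm : 0 < m) (hmj : m ≤ j) (hA : A ⊆ (Finset.range (2 * j + 1)).image f)
    (hcard : j + 4 ≤ 4 * A.card) :
    ∃ i, i + m ≤ 2 * j + 1 ∧
      m ≤ 12 * (A ∩ (Finset.range m).image fun k => f (i + k)).card := by
  by_contra! hcon
  let s : ℕ → ℕ := fun b => min (b * m) (2 * j + 1 - m)
  have hs : ∀ b, s b + m ≤ 2 * j + 1 := fun b => by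
    have : s b ≤ 2 * j + 1 - m := min_le_right _ _
    omega
  have hcover : A ⊆ (Finset.range (2 * j / m + 1)).biUnion
      fun b => A ∩ (Finset.range m).image fun k => f (s b + k) := by
    intro x hx
    obtain ⟨k, hk, rfl⟩ := Finset.mem_image.1 (hA hx)
    rw [Finset.mem_range] at hk
    have h1 : k / m * m ≤ k := Nat.div_mul_le_self k m
    have h2 : k < k / m * m + m := by
      have := Nat.lt_div_mul_add hm (a := k)
      omega
    have h3 : s (k / m) ≤ k := (min_le_left _ _).trans h1
    have h4 : k < s (k / m) + m := by
      simp only [s]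
      omega
    simp only [Finset.mem_biUnion, Finset.mem_inter, Finset.mem_image, Finset.mem_range]
    refine ⟨k / m, Nat.lt_succ_of_le (Nat.div_le_div_right (by omega)), hx, k - s (k / m),
      by omega, ?_⟩
    rw [Nat.add_sub_cancel' h3]
  have h1 : A.card ≤ (2 * j / m + 1) * ((m - 1) / 12) := by
    refine (Finset.card_le_card hcover).trans ?_
    have := Finset.card_biUnion_le_card_mul (Finset.range (2 * j / m + 1))
      (fun b => A ∩ (Finset.range m).image fun k => f (s b + k)) ((m - 1) / 12)
      (fun b _ => by
        have := hcon (s b) (hs b)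
        omega)
    rwa [Finset.card_range] at this
  have h2 : (2 * j / m + 1) * (12 * ((m - 1) / 12)) ≤ (2 * j / m + 1) * m :=
    Nat.mul_le_mul_left _ (by omega)
  have h3 : 2 * j / m * m ≤ 2 * j := Nat.div_mul_le_self _ _
  have h4 : 12 * A.card ≤ (2 * j / m + 1) * m := by
    refine le_trans ?_ h2
    calc 12 * A.card ≤ 12 * ((2 * j / m + 1) * ((m - 1) / 12)) := Nat.mul_le_mul_left _ h1
      _ = _ := by ring
  rw [add_mul] at h4
  omega

/-! ### Explanations on the torus -/

/-- On the unwrapped lattice every error has an explanation, provided an error outside the noise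
comes from two errors among the three voters on one of the lines it reads. -/
theorem exists_lattice_explanation {n : ℕ} {E N : Set (ℤ × ℤ × ZMod n × ℤ)}
    (htime : ∀ p ∈ E, 1 ≤ p.2.2.2)
    (hstep : ∀ p ∈ E, p ∉ N → ∃ e : ℤ, (e = -1 ∨ e = 0 ∨ e = 1) ∧
      ((shift p (0, 0, e, -1) ∈ E ∧ shift p (1, 0, e, -1) ∈ E) ∨
        (shift p (0, 0, e, -1) ∈ E ∧ shift p (0, 1, e, -1) ∈ E) ∨
        (shift p (1, 0, e, -1) ∈ E ∧ shift p (0, 1, e, -1) ∈ E)))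
    {p : ℤ × ℤ × ZMod n × ℤ} (hp : p ∈ E) :
    ∃ V : Finset (ℤ × ℤ × ZMod n × ℤ), p ∈ V ∧ (V : Set (ℤ × ℤ × ZMod n × ℤ)) ⊆ E ∧
      ((siteGraph n).induce (V : Set (ℤ × ℤ × ZMod n × ℤ))).Connected ∧
      ∃ A ⊆ V, V.card + 3 ≤ 4 * A.card ∧ ∀ y ∈ A, y ∈ N := by
  let height : Fin 3 → ℤ × ℤ × ZMod n × ℤ → ℤ :=
    ![fun p => -3 * p.1 - p.2.2.2, fun p => -3 * p.2.1 - p.2.2.2,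
      fun p => 3 * p.1 + 3 * p.2.1 + 2 * p.2.2.2]
  have hchild : ∀ p : ℤ × ℤ × ZMod n × ℤ, ∃ c : Fin 3 → ℤ × ℤ × ZMod n × ℤ, p ∈ E → p ∉ N →
      ∀ i, c i ∈ E ∧ (c i).2.2.2 = p.2.2.2 - 1 ∧ (siteGraph n).Adj p (c i) ∧
        height i (c i) = height i p + 1 ∧
        ∀ j, c i = c j ∨ (siteGraph n).Adj (c i) (c j) := by
    intro p
    by_cases h : p ∈ E ∧ p ∉ N
    swap
    · exact ⟨fun _ => p, fun h1 h2 => absurd ⟨h1, h2⟩ h⟩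
    obtain ⟨e, he, hc⟩ := hstep p h.1 h.2
    have hm0 : (0, 0, e, -1) ∈ moves := by rcases he with rfl | rfl | rfl <;> decide
    have hm1 : (1, 0, e, -1) ∈ moves := by rcases he with rfl | rfl | rfl <;> decide
    have hm2 : (0, 1, e, -1) ∈ moves := by rcases he with rfl | rfl | rfl <;> decide
    have h01 : (siteGraph n).Adj (shift p (0, 0, e, -1)) (shift p (1, 0, e, -1)) :=
      ⟨(1, 0, 0, 0), by decide, by simp [shift]⟩
    have h02 : (siteGraph n).Adj (shift p (0, 0, e, -1)) (shift p (0, 1, e, -1)) :=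
      ⟨(0, 1, 0, 0), by decide, by simp [shift]⟩
    have h12 : (siteGraph n).Adj (shift p (1, 0, e, -1)) (shift p (0, 1, e, -1)) :=
      ⟨(-1, 1, 0, 0), by decide, by simp [shift]⟩
    have ha0 : (siteGraph n).Adj p (shift p (0, 0, e, -1)) := ⟨_, hm0, rfl⟩
    have ha1 : (siteGraph n).Adj p (shift p (1, 0, e, -1)) := ⟨_, hm1, rfl⟩
    have ha2 : (siteGraph n).Adj p (shift p (0, 1, e, -1)) := ⟨_, hm2, rfl⟩
    rcases hc with ⟨hx, hy⟩ | ⟨hx, hy⟩ | ⟨hx, hy⟩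
    · refine ⟨![shift p (0, 0, e, -1), shift p (0, 0, e, -1), shift p (1, 0, e, -1)],
        fun _ _ i => ⟨?_, ?_, ?_, ?_, fun j => ?_⟩⟩
      · fin_cases i <;> assumption
      · fin_cases i <;> simp [shift] <;> ring
      · fin_cases i <;> assumption
      · fin_cases i <;> simp [shift, height] <;> ring
      · fin_cases i <;> fin_cases j <;> simp [h01, h01.symm]
    · refine ⟨![shift p (0, 0, e, -1), shift p (0, 0, e, -1), shift p (0, 1, e, -1)],
        fun _ _ i => ⟨?_, ?_, ?_, ?_, fun j => ?_⟩⟩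
      · fin_cases i <;> assumption
      · fin_cases i <;> simp [shift] <;> ring
      · fin_cases i <;> assumption
      · fin_cases i <;> simp [shift, height] <;> ring
      · fin_cases i <;> fin_cases j <;> simp [h02, h02.symm]
    · refine ⟨![shift p (0, 1, e, -1), shift p (1, 0, e, -1), shift p (1, 0, e, -1)],
        fun _ _ i => ⟨?_, ?_, ?_, ?_, fun j => ?_⟩⟩
      · fin_cases i <;> assumption
      · fin_cases i <;> simp [shift] <;> ring
      · fin_cases i <;> assumption
      · fin_cases i <;> simp [shift, height] <;> ring
      · fin_cases i <;> fin_cases j <;> simp [h12, h12.symm]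
  choose child hc using hchild
  let T : ToomSystem (ℤ × ℤ × ZMod n × ℤ) :=
    { graph := siteGraph n
      time := fun p => p.2.2.2.toNat
      height := height
      err := E
      noise := N
      child := child
      sum_height := fun p => by
        simp only [height, Fin.sum_univ_three, Matrix.cons_val]
        ring
      fork_height := by
        rintro p hp q hq ⟨d, hd, rfl⟩ ht s hs
        have h1 := htime _ hp
        have h2 := htime _ hq
        simp only [shift] at h2 ht
        obtain ⟨h3, h4, h5, -⟩ := horizontal_of_mem_moves d hd (by omega)
        rw [abs_le] at h3 h4 h5
        rw [Fin.sum_univ_three]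
        simp only [height, Matrix.cons_val]
        rcases hs 0 with h | h <;> rcases hs 1 with h' | h' <;> rcases hs 2 with h'' | h'' <;>
          rw [h, h', h''] <;> simp only [shift, Int.cast_id] at * <;> omega
      child_err := fun p hp hn i => (hc p hp hn i).1
      child_time := fun p hp hn i => by
        have h1 := htime _ hp
        have h2 := (hc p hp hn i).2.1
        omega
      child_adj := fun p hp hn i => (hc p hp hn i).2.2.1.symm
      child_height := fun p hp hn i => (hc p hp hn i).2.2.2.1
      child_fork := fun p hp hn i j => (hc p hp hn i).2.2.2.2 j }
  exact T.exists_explanation hp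

/-- On the torus, an error is explained either by a closed walk on whose support the noise has
density more than one quarter, or, when explanations wrap around the torus, there is somewhere
a walk of `m` points of which at least `m / 12` belong to the noise. -/
theorem exists_noisy_walk {m n : ℕ} {E N : Set (ZMod m × ZMod m × ZMod n × ℤ)}
    (htime : ∀ q ∈ E, 1 ≤ q.2.2.2)
    (hstep : ∀ q ∈ E, q ∉ N → ∃ e : ℤ, (e = -1 ∨ e = 0 ∨ e = 1) ∧
      ((shift q (0, 0, e, -1) ∈ E ∧ shift q (1, 0, e, -1) ∈ E) ∨
        (shift q (0, 0, e, -1) ∈ E ∧ shift q (0, 1, e, -1) ∈ E) ∨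
        (shift q (1, 0, e, -1) ∈ E ∧ shift q (0, 1, e, -1) ∈ E)))
    {q : ZMod m × ZMod m × ZMod n × ℤ} (hq : q ∈ E) :
    (∃ j, ∃ W ∈ walkSupports (2 * j) q, W.card ≤ j + 1 ∧
      ∃ A ⊆ W, j + 4 ≤ 4 * A.card ∧ ∀ x ∈ A, x ∈ N) ∨
    (m ≠ 0 ∧ ∃ q' ∈ E, ∃ W ∈ walkSupports (m - 1) q',
      ∃ A ⊆ W, m ≤ 12 * A.card ∧ ∀ x ∈ A, x ∈ N) := by
  classical
  obtain ⟨p, rfl⟩ := wrap_surjective m n q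
  obtain ⟨V, hpV, hVE, hVc, A, hAV, hVn, hAN⟩ := exists_lattice_explanation (E := wrap m ⁻¹' E)
    (N := wrap m ⁻¹' N) (fun p hp => htime _ hp)
    (fun p hp hn => by simpa only [Set.mem_preimage, wrap_shift] using hstep _ hp hn) hq
  obtain ⟨w, hlen, hsupp⟩ := (siteGraph n).exists_closed_walk_support_eq hVc hpV
  obtain ⟨j, hj⟩ : ∃ j, V.card = j + 1 :=
    Nat.exists_eq_succ_of_ne_zero (Finset.card_pos.2 ⟨p, hpV⟩).ne'
  rw [hj, Nat.add_sub_cancel] at hlen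
  have hadj : ∀ i < 2 * j, (siteGraph n).Adj (w.getVert i) (w.getVert (i + 1)) := fun i hi =>
    w.adj_getVert_succ (by omega)
  have himage : (Finset.range (2 * j + 1)).image w.getVert = V := by
    rw [← hsupp]
    ext x
    simp only [Finset.mem_image, Finset.mem_range, List.mem_toFinset,
      SimpleGraph.Walk.mem_support_iff_exists_getVert, hlen]
    exact exists_congr fun i => by rw [and_comm, Nat.lt_succ_iff]
  by_cases hm : m = 0 ∨ j < m
  · left
    have hend : w.getVert (2 * j) = w.getVert 0 := by
      rw [← hlen, w.getVert_length, w.getVert_zero]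
    -- Two points of a closed walk of length `2 j` are at distance at most `j`.
    have hdist : ∀ i k, i + k ≤ 2 * j →
        |(w.getVert (i + k)).1 - (w.getVert i).1| ≤ j ∧
          |(w.getVert (i + k)).2.1 - (w.getVert i).2.1| ≤ j := by
      intro i k hik
      obtain ⟨h1, h2⟩ := abs_sub_le_of_walk hadj i k hik
      obtain ⟨h3, h4⟩ := abs_sub_le_of_walk hadj 0 i (by omega)
      obtain ⟨h5, h6⟩ := abs_sub_le_of_walk hadj (i + k) (2 * j - (i + k)) (by omega)
      rw [Nat.add_sub_cancel' hik, hend] at h5 h6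
      rw [zero_add] at h3 h4
      simp only [abs_le] at *
      push_cast [Nat.cast_sub hik] at *
      constructor <;> constructor <;> omega
    have hinj : Set.InjOn (wrap m) (V : Set (ℤ × ℤ × ZMod n × ℤ)) := by
      intro x hx y hy hxy
      refine eq_of_wrap_eq hxy (hm.imp_right fun hm => ?_)
      rw [← himage] at hx hy
      obtain ⟨i, hi, rfl⟩ := Finset.mem_image.1 hx
      obtain ⟨k, hk, rfl⟩ := Finset.mem_image.1 hy
      rw [Finset.mem_range] at hi hk
      rcases le_total i k with h | h
      · have := hdist i (k - i) (by omega)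
        rw [Nat.add_sub_cancel' h] at this
        rw [abs_sub_comm, abs_sub_comm (w.getVert i).2.1]
        omega
      · have := hdist k (i - k) (by omega)
        rw [Nat.add_sub_cancel' h] at this
        omega
    have hW := image_mem_walkSupports m hadj
    have heq : (Finset.range (2 * j + 1)).image (fun i => wrap m (w.getVert i)) =
        V.image (wrap m) := by
      rw [← himage, Finset.image_image]
      rfl
    rw [heq, w.getVert_zero] at hW
    refine ⟨j, _, hW, Finset.card_image_le.trans hj.le, A.image (wrap m),
      Finset.image_subset_image hAV, ?_, ?_⟩
    · rw [Finset.card_image_of_injOn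
        (hinj.mono (Finset.coe_subset.2 hAV))]
      omega
    · intro x hx
      obtain ⟨y, hy, rfl⟩ := Finset.mem_image.1 hx
      exact hAN y hy
  · right
    push Not at hm
    obtain ⟨i, hi, hcard⟩ := exists_segment_card_le (f := w.getVert) (A := A)
      (Nat.pos_of_ne_zero hm.1) hm.2 (himage ▸ hAV) (by omega)
    have hadj' : ∀ k < m - 1, (siteGraph n).Adj (w.getVert (i + k)) (w.getVert (i + (k + 1))) :=
      fun k hk => hadj (i + k) (by omega)
    have hW := image_mem_walkSupports m (f := fun k => w.getVert (i + k)) hadj'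
    have hmm : m - 1 + 1 = m := by omega
    rw [hmm] at hW
    refine ⟨hm.1, _, ?_, _, hW,
      (A ∩ (Finset.range m).image fun k => w.getVert (i + k)).image (wrap m),
      ?_, ?_, ?_⟩
    · have : w.getVert (i + 0) ∈ V := by
        rw [← himage]
        exact Finset.mem_image_of_mem _ (Finset.mem_range.2 (by omega))
      exact hVE this
    · intro x hx
      simp only [Finset.mem_image, Finset.mem_inter] at hx ⊢
      obtain ⟨y, ⟨-, k, hk, rfl⟩, rfl⟩ := hx
      exact ⟨k, hk, rfl⟩
    · rw [Finset.card_image_of_injOn]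
      · exact hcard
      · intro x hx y hy hxy
        refine eq_of_wrap_eq hxy (.inr ?_)
        simp only [Finset.coe_inter, Finset.coe_image, Set.mem_inter_iff, Set.mem_image,
          Finset.mem_coe, Finset.mem_range] at hx hy
        obtain ⟨-, k, hk, rfl⟩ := hx
        obtain ⟨-, l, hl, rfl⟩ := hy
        rcases le_total k l with h | h
        · have := abs_sub_le_of_walk hadj' k (l - k) (by omega)
          rw [Nat.add_sub_cancel' h] at this
          rw [abs_sub_comm, abs_sub_comm (w.getVert (i + k)).2.1]
          omega
        · have := abs_sub_le_of_walk hadj' l (k - l) (by omega)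
          rw [Nat.add_sub_cancel' h] at this
          omega
    · intro x hx
      obtain ⟨y, hy, rfl⟩ := Finset.mem_image.1 hx
      exact hAN y (Finset.mem_inter.1 hy).1

/-! ### Errors and noise -/

theorem two_ne_of_maj_ne {S : Type*} {tie : S → S → S → S} {x y z s : S}
    (h : maj tie x y z ≠ s) : (x ≠ s ∧ y ≠ s) ∨ (x ≠ s ∧ z ≠ s) ∨ (y ≠ s ∧ z ≠ s) := by
  unfold maj at h
  grind

/-- The event that the rule is disobeyed at the cell `x` in the step from time `k` to `k + 1`. -/
def noiseEvent {Ω S : Type*} {m n : ℕ} (trans tie : S → S → S → S) (η : Ω → Cell m n → ℕ → S)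
    (x : Cell m n) (k : ℕ) : Set Ω :=
  {ω | η ω x (k + 1) ≠ spaceStep trans tie (fun y => η ω y k) x}

/-- The space-time sites, at times between `1` and `t`, at which the rule is disobeyed. -/
def noiseSites {Ω S : Type*} {m n : ℕ} (trans tie : S → S → S → S) (η : Ω → Cell m n → ℕ → S)
    (t : ℕ) (ω : Ω) : Set (ZMod m × ZMod m × ZMod n × ℤ) :=
  {q | 1 ≤ q.2.2.2 ∧ q.2.2.2 ≤ t ∧
    ω ∈ noiseEvent trans tie η (q.1, q.2.1, q.2.2.1) (q.2.2.2 - 1).toNat}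

/-- The space-time sites, at times between `1` and `t`, whose state is not the intended one. -/
def errorSites {Ω S : Type*} {m n : ℕ} (ζ : ZMod n → ℕ → S) (η : Ω → Cell m n → ℕ → S)
    (t : ℕ) (ω : Ω) : Set (ZMod m × ZMod m × ZMod n × ℤ) :=
  {q | 1 ≤ q.2.2.2 ∧ q.2.2.2 ≤ t ∧ η ω (q.1, q.2.1, q.2.2.1) q.2.2.2.toNat ≠ ζ q.2.2.1 q.2.2.2.toNat}

/-- An error outside the noise reads a wrong majority on one of its three lines, hence comes from
two errors among three voters. -/
theorem exists_two_errors {Ω S : Type*} {m n : ℕ} {trans tie : S → S → S → S} {I : Set ℕ}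
    (hI : I.OrdConnected) (hI0 : 0 ∈ I) {ζ : ZMod n → ℕ → S}
    (hζ : IsTrajectory I (lineStep trans) ζ) {η : Ω → Cell m n → ℕ → S} {t : ℕ} (ht : t ∈ I) {ω : Ω}
    (hω : ∀ w, η ω w 0 = planeLift m ζ w 0) {q : ZMod m × ZMod m × ZMod n × ℤ}
    (hq : q ∈ errorSites ζ η t ω) (hn : q ∉ noiseSites trans tie η t ω) :
    ∃ e : ℤ, (e = -1 ∨ e = 0 ∨ e = 1) ∧
      ((shift q (0, 0, e, -1) ∈ errorSites ζ η t ω ∧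
          shift q (1, 0, e, -1) ∈ errorSites ζ η t ω) ∨
        (shift q (0, 0, e, -1) ∈ errorSites ζ η t ω ∧
          shift q (0, 1, e, -1) ∈ errorSites ζ η t ω) ∨
        (shift q (1, 0, e, -1) ∈ errorSites ζ η t ω ∧
          shift q (0, 1, e, -1) ∈ errorSites ζ η t ω)) := by
  obtain ⟨a, b, u, s⟩ := q
  obtain ⟨h1, h2, h3⟩ := hq
  dsimp only at h1 h2 h3
  obtain ⟨k, rfl⟩ : ∃ k : ℕ, s = k + 1 := ⟨(s - 1).toNat, by omega⟩
  have hk : k + 1 ≤ t := by omega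
  have hk1 : k + 1 ∈ I := hI.out hI0 ht ⟨by omega, hk⟩
  have hk0 : k ∈ I := hI.out hI0 ht ⟨by omega, by omega⟩
  have htoNat : ((k : ℤ) + 1).toNat = k + 1 := by omega
  rw [htoNat] at h3
  -- At time `0` there are no errors, so an error at time `k` is at a time between `1` and `t`.
  have hmem : ∀ (a' b' : ZMod m) (u' : ZMod n), η ω (a', b', u') k ≠ ζ u' k →
      ((a', b', u', (k : ℤ)) : ZMod m × ZMod m × ZMod n × ℤ) ∈ errorSites ζ η t ω := by
    intro a' b' u' h
    have : k ≠ 0 := by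
      rintro rfl
      exact h (hω _)
    exact ⟨by dsimp only; omega, by dsimp only; omega, by simpa using h⟩
  have hrule : η ω (a, b, u) (k + 1) = spaceStep trans tie (fun y => η ω y k) (a, b, u) := by
    by_contra hne
    refine hn ⟨h1, h2, ?_⟩
    simpa [noiseEvent] using hne
  rw [hrule, hζ u k hk0 hk1] at h3
  have hmaj : ∃ e : ℤ, (e = -1 ∨ e = 0 ∨ e = 1) ∧
      toomStep tie (fun y => η ω y k) (a, b, u + e) ≠ ζ (u + e) k := by
    by_contra! hcon
    apply h3
    have e0 := hcon (-1) (by simp)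
    have e1 := hcon 0 (by simp)
    have e2 := hcon 1 (by simp)
    simp only [Int.cast_neg, Int.cast_one, Int.cast_zero, add_zero, ← sub_eq_add_neg] at e0 e1 e2
    simp only [spaceStep, lineStep, e0, e1, e2]
  obtain ⟨e, he, hmaj⟩ := hmaj
  refine ⟨e, he, ?_⟩
  have hsh : ∀ x y : ℤ, shift ((a, b, u, (k : ℤ) + 1) : ZMod m × ZMod m × ZMod n × ℤ) (x, y, e, -1) =
      (a + x, b + y, u + e, (k : ℤ)) := by
    intro x y
    simp [shift]
  simp only [hsh, Int.cast_zero, Int.cast_one, add_zero]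
  exact (two_ne_of_maj_ne hmaj).imp (fun h => ⟨hmem _ _ _ h.1, hmem _ _ _ h.2⟩)
    (Or.imp (fun h => ⟨hmem _ _ _ h.1, hmem _ _ _ h.2⟩)
      (fun h => ⟨hmem _ _ _ h.1, hmem _ _ _ h.2⟩))

/-! ### The probability of noise -/

theorem measurable_spaceStep {Ω S : Type*} [Finite S] [MeasurableSpace S]
    [MeasurableSingletonClass S] [MeasurableSpace Ω] {m n : ℕ} (trans tie : S → S → S → S)
    {c : Ω → Cell m n → S} (hc : ∀ x, Measurable fun ω => c ω x) (x : Cell m n) :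
    Measurable fun ω => spaceStep trans tie (c ω) x := by
  have h3 : ∀ (g : S → S → S → S) (f₁ f₂ f₃ : Ω → S), Measurable f₁ → Measurable f₂ →
      Measurable f₃ → Measurable fun ω => g (f₁ ω) (f₂ ω) (f₃ ω) := by
    intro g f₁ f₂ f₃ h₁ h₂ h₃
    have hg : Measurable fun p : S × S × S => g p.1 p.2.1 p.2.2 := Measurable.of_discrete
    exact hg.comp (h₁.prodMk (h₂.prodMk h₃))
  exact h3 trans _ _ _ (h3 (maj tie) _ _ _ (hc _) (hc _) (hc _))
    (h3 (maj tie) _ _ _ (hc _) (hc _) (hc _)) (h3 (maj tie) _ _ _ (hc _) (hc _) (hc _))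

theorem measurableSet_noiseEvent {Ω S : Type*} [Finite S] [MeasurableSpace S]
    [MeasurableSingletonClass S] [MeasurableSpace Ω] {m n : ℕ} (trans tie : S → S → S → S)
    {η : Ω → Cell m n → ℕ → S} {x : Cell m n} {k : ℕ} (hx : Measurable fun ω => η ω x (k + 1))
    (hk : ∀ y, Measurable fun ω => η ω y k) : MeasurableSet (noiseEvent trans tie η x k) :=
  (hx.prodMk (measurable_spaceStep trans tie hk x))
    (MeasurableSet.of_discrete (s := {p : S × S | p.1 ≠ p.2}))

/-- The noise is dominated by independent noise of rate `ε`: conditioning on the other sites, in the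
order of time, shows that a given set of sites is noisy with probability at most `ε` to the power of
its cardinality. -/
theorem measure_iInter_noiseEvent_le {Ω S : Type*} [Finite S] [MeasurableSpace S]
    [MeasurableSingletonClass S] [MeasurableSpace Ω] {μ : Measure Ω} [IsProbabilityMeasure μ]
    {trans tie : S → S → S → S} {m n : ℕ} {I : Set ℕ} {ε : ℝ} (hε : 0 ≤ ε)
    {η : Ω → Cell m n → ℕ → S} (hη : IsPerturbedTrajectory μ I (spaceStep trans tie) ε η)
    (A : Finset (Cell m n × ℕ)) (hA : ∀ x ∈ A, x.2 ∈ I ∧ x.2 + 1 ∈ I) :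
    μ (⋂ x ∈ A, noiseEvent trans tie η x.1 x.2) ≤ ENNReal.ofReal (ε ^ A.card) := by
  classical
  revert hA
  induction A using Finset.induction_on_max_value (fun x : Cell m n × ℕ => x.2) with
  | empty => simp
  | insert a s has hmax ih =>
    intro hA
    obtain ⟨ha0, ha1⟩ := hA a (Finset.mem_insert_self _ _)
    have hs : ∀ x ∈ s, x.2 ∈ I ∧ x.2 + 1 ∈ I := fun x hx => hA x (Finset.mem_insert_of_mem hx)
    set N := noiseEvent trans tie η a.1 a.2
    set B := ⋂ x ∈ s, noiseEvent trans tie η x.1 x.2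
    have hNm : MeasurableSet N := measurableSet_noiseEvent trans tie
      (hη.measurable _ _ ha1) (fun y => hη.measurable _ _ ha0)
    have hle : otherSigma I η a.1 (a.2 + 1) ≤ (inferInstance : MeasurableSpace Ω) :=
      iSup₂_le fun p hp => (hη.measurable p.1 p.2 hp.1).comap_le
    have hmeas : ∀ (y : Cell m n) (k : ℕ), k ∈ I → (k < a.2 + 1 ∨ (k = a.2 + 1 ∧ y ≠ a.1)) →
        Measurable[otherSigma I η a.1 (a.2 + 1)] fun ω => η ω y k := by
      intro y k hk h
      rw [measurable_iff_comap_le]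
      exact le_iSup₂_of_le (f := fun (p : Cell m n × ℕ)
        (_ : p.2 ∈ I ∧ (p.2 < a.2 + 1 ∨ (p.2 = a.2 + 1 ∧ p.1 ≠ a.1))) =>
          MeasurableSpace.comap (fun ω => η ω p.1 p.2) inferInstance) (y, k) ⟨hk, h⟩ le_rfl
    have hBm : MeasurableSet[otherSigma I η a.1 (a.2 + 1)] B := by
      refine Finset.measurableSet_biInter _ fun x hx => ?_
      have hxa := hmax x hx
      refine @measurableSet_noiseEvent _ _ _ _ _ (otherSigma I η a.1 (a.2 + 1)) _ _ _ _ _ _ _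
        (hmeas _ _ (hs x hx).2 ?_) (fun y => hmeas _ _ (hs x hx).1 (.inl (by omega)))
      rcases hxa.lt_or_eq with h | h
      · exact .inl (by omega)
      · refine .inr ⟨by omega, fun h' => has ?_⟩
        rwa [← Prod.ext h' h]
    have hint : Integrable (N.indicator fun _ => (1 : ℝ)) μ :=
      (integrable_const 1).indicator hNm
    have hreal : μ.real (N ∩ B) ≤ ε * μ.real B := by
      calc μ.real (N ∩ B) = ∫ ω in B, N.indicator (fun _ => (1 : ℝ)) ω ∂μ := by
            rw [integral_indicator hNm, Measure.restrict_restrict hNm]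
            simp [Measure.real]
        _ = ∫ ω in B, (μ[N.indicator (fun _ => (1 : ℝ)) | otherSigma I η a.1 (a.2 + 1)]) ω ∂μ :=
            (setIntegral_condExp hle hint hBm).symm
        _ ≤ ∫ _ in B, ε ∂μ :=
            setIntegral_mono_ae integrable_condExp.integrableOn (integrable_const ε).integrableOn
              (hη.noise_le a.1 a.2 ha0 ha1)
        _ = ε * μ.real B := by
            rw [setIntegral_const, smul_eq_mul, mul_comm]
    have hset : ⋂ x ∈ insert a s, noiseEvent trans tie η x.1 x.2 = N ∩ B := by
      rw [Finset.set_biInter_insert]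
    rw [hset, Finset.card_insert_of_notMem has, pow_succ', ENNReal.ofReal_mul hε,
      ← ENNReal.ofReal_toReal (measure_ne_top μ (N ∩ B))]
    calc ENNReal.ofReal (μ (N ∩ B)).toReal ≤ ENNReal.ofReal (ε * μ.real B) :=
          ENNReal.ofReal_le_ofReal hreal
      _ = ENNReal.ofReal ε * μ B := by
          rw [ENNReal.ofReal_mul hε, Measure.real, ENNReal.ofReal_toReal (measure_ne_top μ B)]
      _ ≤ ENNReal.ofReal ε * ENNReal.ofReal (ε ^ s.card) := by
          gcongr
          exact ih hs

theorem measure_noiseSites_le {Ω S : Type*} [Finite S] [MeasurableSpace S]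
    [MeasurableSingletonClass S] [MeasurableSpace Ω] {μ : Measure Ω} [IsProbabilityMeasure μ]
    {trans tie : S → S → S → S} {m n : ℕ} {I : Set ℕ} (hI : I.OrdConnected) (hI0 : 0 ∈ I)
    {ε : ℝ} (hε : 0 ≤ ε) {η : Ω → Cell m n → ℕ → S}
    (hη : IsPerturbedTrajectory μ I (spaceStep trans tie) ε η) {t : ℕ} (ht : t ∈ I)
    (A : Finset (ZMod m × ZMod m × ZMod n × ℤ)) :
    μ {ω | ∀ q ∈ A, q ∈ noiseSites trans tie η t ω} ≤ ENNReal.ofReal (ε ^ A.card) := by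
  classical
  by_cases hA : ∀ q ∈ A, 1 ≤ q.2.2.2 ∧ q.2.2.2 ≤ t
  swap
  · push Not at hA
    obtain ⟨q, hq, h⟩ := hA
    have : {ω | ∀ q ∈ A, q ∈ noiseSites trans tie η t ω} = ∅ := by
      rw [Set.eq_empty_iff_forall_notMem]
      intro ω hω
      obtain ⟨h1, h2, -⟩ := hω q hq
      have := h h1
      omega
    rw [this, measure_empty]
    exact zero_le
  let g : ZMod m × ZMod m × ZMod n × ℤ → Cell m n × ℕ := fun q =>
    ((q.1, q.2.1, q.2.2.1), (q.2.2.2 - 1).toNat)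
  have hg : Set.InjOn g A := by
    rintro ⟨a, b, u, s⟩ hx ⟨a', b', u', s'⟩ hy hxy
    have h1 := hA _ hx
    have h2 := hA _ hy
    simp only [g, Prod.mk.injEq] at hxy h1 h2 ⊢
    refine ⟨hxy.1.1, hxy.1.2.1, hxy.1.2.2, by omega⟩
  rw [← Finset.card_image_of_injOn hg]
  refine (measure_mono ?_).trans (measure_iInter_noiseEvent_le hε hη (A.image g) ?_)
  · intro ω hω
    simp only [Finset.mem_image, Set.mem_iInter]
    rintro _ ⟨q, hq, rfl⟩
    exact (hω q hq).2.2
  · intro x hx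
    obtain ⟨q, hq, rfl⟩ := Finset.mem_image.1 hx
    have := hA q hq
    exact ⟨hI.out hI0 ht ⟨by omega, by simp only [g]; omega⟩,
      hI.out hI0 ht ⟨by omega, by simp only [g]; omega⟩⟩

/-- The union bound over walks of length `L` and over subsets of their supports. The noise rate is
`δ ^ κ`, so that a subset of at least `M / κ` points contributes at most `δ ^ M`. -/
theorem measure_noisy_walk_le {Ω S : Type*} [Finite S] [MeasurableSpace S]
    [MeasurableSingletonClass S] [MeasurableSpace Ω] {μ : Measure Ω} [IsProbabilityMeasure μ]
    {trans tie : S → S → S → S} {m n : ℕ} {I : Set ℕ} (hI : I.OrdConnected) (hI0 : 0 ∈ I)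
    {δ : ℝ} (hδ : 0 ≤ δ) (hδ1 : δ ≤ 1) {κ : ℕ} {η : Ω → Cell m n → ℕ → S}
    (hη : IsPerturbedTrajectory μ I (spaceStep trans tie) (δ ^ κ) η) {t : ℕ} (ht : t ∈ I)
    (q : ZMod m × ZMod m × ZMod n × ℤ) (L K M : ℕ) :
    μ {ω | ∃ W ∈ walkSupports L q, W.card ≤ K ∧
      ∃ A ⊆ W, M ≤ κ * A.card ∧ ∀ x ∈ A, x ∈ noiseSites trans tie η t ω} ≤
      ENNReal.ofReal (24 ^ L * (2 ^ K * δ ^ M)) := by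
  classical
  have hsub : {ω | ∃ W ∈ walkSupports L q, W.card ≤ K ∧
      ∃ A ⊆ W, M ≤ κ * A.card ∧ ∀ x ∈ A, x ∈ noiseSites trans tie η t ω} ⊆
      ⋃ W ∈ {W ∈ walkSupports L q | W.card ≤ K}, ⋃ A ∈ {A ∈ W.powerset | M ≤ κ * A.card},
        {ω | ∀ x ∈ A, x ∈ noiseSites trans tie η t ω} := by
    rintro ω ⟨W, hW, hK, A, hA, hM, h⟩
    simp only [Set.mem_iUnion, Finset.mem_filter, Finset.mem_powerset]
    exact ⟨W, ⟨hW, hK⟩, A, ⟨hA, hM⟩, h⟩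
  refine (measure_mono hsub).trans ((measure_biUnion_finset_le _ _).trans ?_)
  have hW : ∀ W ∈ {W ∈ walkSupports L q | W.card ≤ K},
      μ (⋃ A ∈ {A ∈ W.powerset | M ≤ κ * A.card},
        {ω | ∀ x ∈ A, x ∈ noiseSites trans tie η t ω}) ≤ ENNReal.ofReal (2 ^ K * δ ^ M) := by
    intro W hW
    refine (measure_biUnion_finset_le _ _).trans ?_
    calc ∑ A ∈ {A ∈ W.powerset | M ≤ κ * A.card}, μ {ω | ∀ x ∈ A, x ∈ noiseSites trans tie η t ω}
        ≤ ∑ _A ∈ {A ∈ W.powerset | M ≤ κ * A.card}, ENNReal.ofReal (δ ^ M) := by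
          refine Finset.sum_le_sum fun A hA => ?_
          refine (measure_noiseSites_le hI hI0 (pow_nonneg hδ κ) hη ht A).trans ?_
          rw [← pow_mul]
          exact ENNReal.ofReal_le_ofReal
            (pow_le_pow_of_le_one hδ hδ1 (Finset.mem_filter.1 hA).2)
      _ = ({A ∈ W.powerset | M ≤ κ * A.card}.card : ℝ≥0∞) * ENNReal.ofReal (δ ^ M) := by
          rw [Finset.sum_const, nsmul_eq_mul]
      _ ≤ ((2 ^ K : ℕ) : ℝ≥0∞) * ENNReal.ofReal (δ ^ M) := by
          gcongr
          refine (Finset.card_filter_le _ _).trans ?_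
          rw [Finset.card_powerset]
          exact Nat.pow_le_pow_right (by norm_num) (Finset.mem_filter.1 hW).2
      _ = ENNReal.ofReal (2 ^ K * δ ^ M) := by
          rw [ENNReal.ofReal_mul (by positivity), ← ENNReal.ofReal_natCast]
          norm_num
  calc ∑ W ∈ {W ∈ walkSupports L q | W.card ≤ K}, _
      ≤ ∑ _W ∈ {W ∈ walkSupports L q | W.card ≤ K}, ENNReal.ofReal (2 ^ K * δ ^ M) :=
        Finset.sum_le_sum hW
    _ = ({W ∈ walkSupports L q | W.card ≤ K}.card : ℝ≥0∞) * ENNReal.ofReal (2 ^ K * δ ^ M) := by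
        rw [Finset.sum_const, nsmul_eq_mul]
    _ ≤ ((24 ^ L : ℕ) : ℝ≥0∞) * ENNReal.ofReal (2 ^ K * δ ^ M) := by
        gcongr
        exact (Finset.card_filter_le _ _).trans (card_walkSupports_le L q)
    _ = ENNReal.ofReal (24 ^ L * (2 ^ K * δ ^ M)) := by
        rw [ENNReal.ofReal_mul (p := 24 ^ L) (by positivity), ← ENNReal.ofReal_natCast]
        norm_num

/-! ### The two terms of the bound -/

theorem tsum_closed_walk_bound_le {δ : ℝ} (hδ : 0 ≤ δ) (h : δ ^ 4 < 1 / (32 * 24 ^ 8)) :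
    ∑' j : ℕ, ENNReal.ofReal (24 ^ (2 * j) * (2 ^ (j + 1) * δ ^ (j + 4))) ≤
      ENNReal.ofReal (96 * δ ^ 4) := by
  have hlt : 1152 * δ ≤ 9 / 10 := by
    by_contra! hcon
    have h1 : (9 / 10 : ℝ) ^ 4 < (1152 * δ) ^ 4 := pow_lt_pow_left₀ hcon (by norm_num) (by norm_num)
    rw [mul_pow] at h1
    norm_num at h1 h
    linarith
  have hterm : ∀ j : ℕ, (24 : ℝ) ^ (2 * j) * (2 ^ (j + 1) * δ ^ (j + 4)) =
      2 * δ ^ 4 * (1152 * δ) ^ j := by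
    intro j
    rw [show (1152 : ℝ) = 24 ^ 2 * 2 by norm_num, mul_pow _ δ, mul_pow _ (2 : ℝ), pow_mul]
    ring
  have hsum : HasSum (fun j : ℕ => 2 * δ ^ 4 * (1152 * δ) ^ j) (2 * δ ^ 4 * (1 - 1152 * δ)⁻¹) :=
    (hasSum_geometric_of_lt_one (by positivity) (by linarith)).mul_left _
  simp_rw [hterm]
  rw [← ENNReal.ofReal_tsum_of_nonneg (fun j => by positivity) hsum.summable, hsum.tsum_eq]
  refine ENNReal.ofReal_le_ofReal ?_
  have hinv : (1 - 1152 * δ)⁻¹ ≤ 10 := by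
    rw [inv_le_comm₀ (by linarith) (by norm_num)]
    linarith
  have h4 : 0 ≤ δ ^ 4 := by positivity
  nlinarith

/-- The starting points of the long walks range over `t` times and all cells. In `ℝ≥0∞` this covers
an infinite third coordinate as well, with `∞ * 0 = 0`. -/
theorem tsum_long_walk_bound_le {m : ℕ} (hm : m ≠ 0) (n t : ℕ) {θ : ℝ} (hθ : 0 ≤ θ) :
    ∑' _ : ZMod m × ZMod m × ZMod n × Fin t,
        ENNReal.ofReal (24 ^ (m - 1) * (2 ^ m * θ ^ m)) ≤
      ((t : ℝ≥0∞) * (ENat.card (ZMod n) : ℝ≥0∞)) *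
        ENNReal.ofReal (2 * 24 * (m : ℝ) ^ 2 * (2 * 24 ^ 2 * θ) ^ m) := by
  have : NeZero m := ⟨hm⟩
  have hcard : (ENat.card (ZMod m) : ℝ≥0∞) = m := by
    rw [ENat.card_eq_coe_fintype_card, ZMod.card]
    simp
  have hfin : (ENat.card (Fin t) : ℝ≥0∞) = t := by
    rw [ENat.card_eq_coe_fintype_card, Fintype.card_fin]
    simp
  rw [ENNReal.tsum_const]
  simp only [ENat.card_prod, ENat.toENNReal_mul, hcard, hfin]
  have hle : (24 : ℝ) ^ (m - 1) * (2 ^ m * θ ^ m) ≤ 2 * 24 * (2 * 24 ^ 2 * θ) ^ m := by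
    have h1 : (24 : ℝ) ^ (m - 1) ≤ (24 ^ 2) ^ m := by
      rw [← pow_mul]
      exact pow_le_pow_right₀ (by norm_num) (by omega)
    rw [mul_pow, mul_pow]
    have h2 : (0 : ℝ) ≤ 2 ^ m * θ ^ m := by positivity
    have h3 := mul_le_mul_of_nonneg_right h1 h2
    have h4 : (0 : ℝ) ≤ (24 ^ 2) ^ m * (2 ^ m * θ ^ m) := by positivity
    nlinarith
  calc (m : ℝ≥0∞) * (m * ((ENat.card (ZMod n) : ℝ≥0∞) * t)) *
        ENNReal.ofReal (24 ^ (m - 1) * (2 ^ m * θ ^ m))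
      ≤ (m : ℝ≥0∞) * (m * ((ENat.card (ZMod n) : ℝ≥0∞) * t)) *
        ENNReal.ofReal (2 * 24 * (2 * 24 ^ 2 * θ) ^ m) := by
        gcongr
    _ = _ := by
        have hX : (0 : ℝ) ≤ 2 * 24 * (2 * 24 ^ 2 * θ) ^ m := by positivity
        rw [show 2 * 24 * (m : ℝ) ^ 2 * (2 * 24 ^ 2 * θ) ^ m =
          (m : ℝ) * ((m : ℝ) * (2 * 24 * (2 * 24 ^ 2 * θ) ^ m)) by ring]
        generalize 2 * 24 * (2 * 24 ^ 2 * θ) ^ m = X at hX ⊢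
        rw [ENNReal.ofReal_mul (by positivity), ENNReal.ofReal_mul (by positivity),
          ENNReal.ofReal_natCast]
        ring

/-- Both cases of the theorem at once: for `m = 0` the long walks do not occur. -/
theorem measure_error_le {S Ω : Type*} [Finite S] [MeasurableSpace S] [MeasurableSingletonClass S]
    [MeasurableSpace Ω] (μ : Measure Ω) [IsProbabilityMeasure μ]
    (trans tie : S → S → S → S) (m n : ℕ) {I : Set ℕ} (hI : I.OrdConnected) (hI0 : 0 ∈ I)
    {ε : ℝ} (hε0 : 0 ≤ ε) (hε : ε < 1 / (32 * 24 ^ 8))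
    {ζ : ZMod n → ℕ → S} (hζ : IsTrajectory I (lineStep trans) ζ) {η : Ω → Cell m n → ℕ → S}
    (hη : IsPerturbedTrajectory μ I (spaceStep trans tie) ε η)
    (hinit : ∀ w : Cell m n, ∀ᵐ ω ∂μ, η ω w 0 = planeLift m ζ w 0)
    (w : Cell m n) {t : ℕ} (ht : t ∈ I) :
    μ {ω | η ω w t ≠ planeLift m ζ w t} ≤ ENNReal.ofReal (4 * 24 * ε) +
      if m = 0 then 0 else ((t : ℝ≥0∞) * (ENat.card (ZMod n) : ℝ≥0∞)) *
        ENNReal.ofReal (2 * 24 * (m : ℝ) ^ 2 * (2 * 24 ^ 2 * ε ^ ((1 : ℝ) / 12)) ^ m) := by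
  have hcount : ∀ k, Countable (ZMod k) := fun k => (ZMod.intCast_surjective (n := k)).countable
  have hε1 : ε ≤ 1 := hε.le.trans (by norm_num)
  -- The noise rate as a fourth and as a twelfth power.
  obtain ⟨δ, hδ, hδ1, rfl⟩ : ∃ δ : ℝ, 0 ≤ δ ∧ δ ≤ 1 ∧ δ ^ 4 = ε :=
    ⟨ε ^ ((4 : ℕ) : ℝ)⁻¹, Real.rpow_nonneg hε0 _, Real.rpow_le_one hε0 hε1 (by positivity),
      Real.rpow_inv_natCast_pow hε0 (by norm_num)⟩
  set θ : ℝ := (δ ^ 4) ^ ((1 : ℝ) / 12) with hθdef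
  have hθ : 0 ≤ θ := Real.rpow_nonneg hε0 _
  have hθ1 : θ ≤ 1 := Real.rpow_le_one hε0 hε1 (by norm_num)
  have hθε : δ ^ 4 = θ ^ 12 := by
    rw [hθdef, ← Real.rpow_mul_natCast hε0]
    norm_num
  set q : ZMod m × ZMod m × ZMod n × ℤ := (w.1, w.2.1, w.2.2, (t : ℤ))
  let short : ℕ → Set Ω := fun j => {ω | ∃ W ∈ walkSupports (2 * j) q, W.card ≤ j + 1 ∧
    ∃ A ⊆ W, j + 4 ≤ 4 * A.card ∧ ∀ x ∈ A, x ∈ noiseSites trans tie η t ω}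
  let long : ZMod m × ZMod m × ZMod n × Fin t → Set Ω := fun s =>
    {ω | ∃ W ∈ walkSupports (m - 1) ((s.1, s.2.1, s.2.2.1, (s.2.2.2 : ℤ) + 1) :
        ZMod m × ZMod m × ZMod n × ℤ), W.card ≤ m ∧
      ∃ A ⊆ W, m ≤ 12 * A.card ∧ ∀ x ∈ A, x ∈ noiseSites trans tie η t ω}
  have hsub : {ω | η ω w t ≠ planeLift m ζ w t} ≤ᵐ[μ]
      ((⋃ j, short j) ∪ if m = 0 then ∅ else ⋃ s, long s : Set Ω) := by
    filter_upwards [ae_all_iff.2 hinit] with ω hω herr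
    have herr' : η ω w t ≠ ζ w.2.2 t := herr
    have ht0 : t ≠ 0 := by
      rintro rfl
      exact herr (hω w)
    have hqE : q ∈ errorSites ζ η t ω :=
      ⟨by dsimp only [q]; omega, le_rfl, by simpa [q] using herr'⟩
    rcases exists_noisy_walk (fun q hq => hq.1)
      (fun q hq hn => exists_two_errors hI hI0 hζ ht hω hq hn) hqE with
      ⟨j, W, hW, hK, A, hA, hM, hN⟩ | ⟨hm, q', ⟨h1, h2, -⟩, W, hW, A, hA, hM, hN⟩
    · exact .inl (Set.mem_iUnion.2 ⟨j, W, hW, hK, A, hA, hM, hN⟩)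
    · refine .inr ?_
      rw [if_neg hm]
      obtain ⟨a, b, u, s⟩ := q'
      dsimp only at h1 h2
      refine Set.mem_iUnion.2 ⟨(a, b, u, ⟨(s - 1).toNat, by omega⟩), W, ?_, ?_, A, hA, hM, hN⟩
      · have hs : (((s - 1).toNat : ℕ) : ℤ) + 1 = s := by omega
        simpa only [hs] using hW
      · have := card_le_of_mem_walkSupports hW
        omega
  refine (measure_mono_ae hsub).trans ((measure_union_le _ _).trans (add_le_add ?_ ?_))
  · refine (measure_iUnion_le _).trans (le_trans (ENNReal.tsum_le_tsum fun j => ?_)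
      ((tsum_closed_walk_bound_le hδ hε).trans (ENNReal.ofReal_le_ofReal (by linarith))))
    exact measure_noisy_walk_le hI hI0 hδ hδ1 hη ht q (2 * j) (j + 1) (j + 4)
  · split_ifs with hm
    · simp
    refine (measure_iUnion_le _).trans (le_trans (ENNReal.tsum_le_tsum fun s => ?_)
      (tsum_long_walk_bound_le hm n t hθ))
    rw [hθε] at hη
    exact measure_noisy_walk_le hI hI0 hθ hθ1 hη ht _ (m - 1) m m

theorem theorem1 {S Ω : Type*} [Finite S] [MeasurableSpace S] [MeasurableSingletonClass S]
    [MeasurableSpace Ω] (μ : Measure Ω) [IsProbabilityMeasure μ]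
    (trans tie : S → S → S → S) (m n : ℕ)
    (I : Set ℕ) (hI : I.OrdConnected) (hI0 : 0 ∈ I)
    (r ε : ℝ) (hr : r = 24) (hε0 : 0 ≤ ε) (hε : ε < 1 / (32 * r ^ 8))
    (ζ : ZMod n → ℕ → S) (hζ : IsTrajectory I (lineStep trans) ζ)
    (η : Ω → Cell m n → ℕ → S)
    (hη : IsPerturbedTrajectory μ I (spaceStep trans tie) ε η)
    (hinit : ∀ w : Cell m n, ∀ᵐ ω ∂μ, η ω w 0 = planeLift m ζ w 0) :
    (m = 0 → ∀ (w : Cell m n), ∀ t ∈ I,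
      μ {ω | η ω w t ≠ planeLift m ζ w t} ≤ ENNReal.ofReal (4 * r * ε)) ∧
    (m ≠ 0 → ∀ (w : Cell m n), ∀ t ∈ I,
      μ {ω | η ω w t ≠ planeLift m ζ w t} ≤
        ENNReal.ofReal (4 * r * ε) +
          ((t : ℝ≥0∞) * (ENat.card (ZMod n) : ℝ≥0∞)) *
            ENNReal.ofReal (2 * r * (m : ℝ) ^ 2 * (2 * r ^ 2 * ε ^ ((1 : ℝ) / 12)) ^ m)) := by
  subst hr
  refine ⟨fun hm w t ht => ?_, fun hm w t ht => ?_⟩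
  · simpa only [if_pos hm, add_zero] using
      measure_error_le μ trans tie m n hI hI0 hε0 hε hζ hη hinit w ht
  · simpa only [if_neg hm] using
      measure_error_le μ trans tie m n hI hI0 hε0 hε hζ hη hinit w ht
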